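/- \textbf{Theorem.} For a finite binary string $u$ let $K(u)$ denote its (plain) Kolmogorov complexity, i.e. the minimal length of a program that makes a fixed optimal decompressor (a partial computable map from binary strings to binary strings whose complexity function is minimal up to an additive constant) output $u$. For an infinite binary sequence $\omega=\omega_0\omega_1\omega_2\dots$ write $\omega([k,k+n))=\omega_k\omega_{k+1}\dots\omega_{k+n-1}$. For a real number $\alpha$, the sequence $\omega$ is called $\alpha$-everywhere complex if there is a constant $c$ such that $$K(\omega([k,k+n)))\ge \alpha n-c\qquad\text{for all natural numbers } k \text{ and } n.$$ Consider any probabilistic algorithm, that is, an algorithm with access to a generator of independent fair random bits that writes output bits one after another (its output may be finite or infinite). Then the probability that its output is an infinite sequence that is $\alpha$-everywhere complex for some $\alpha\in(0,1)$ (where $\alpha$ may depend on the output sequence) equals $0$. -/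

import Mathlib

open MeasureTheory
open scoped ENNReal

namespace EverywhereComplex

/-- `complexity D x`: the minimal length of a program `p` on which the decompressor `D` halts with
output `x`; it is `⊤` if there is no such program. -/
noncomputable def complexity (D : List Bool →. List Bool) (x : List Bool) : ℕ∞ :=
  ⨅ p : List Bool, ⨅ _ : x ∈ D p, (p.length : ℕ∞)

/-- `U` is an optimal decompressor: it is partial computable, and its complexity function is, up to
an additive constant, not larger than that of any other partial computable decompressor. For such a
`U`, `complexity U` is (plain) Kolmogorov complexity. -/
structure IsOptimal (U : List Bool →. List Bool) : Prop where
  partrec : Partrec U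
  le_add : ∀ D : List Bool →. List Bool, Partrec D →
    ∃ c : ℕ, ∀ x : List Bool, complexity U x ≤ complexity D x + c

/-- The substring `ω_k ω_{k+1} … ω_{k+n-1}` of `ω`. -/
def substring (ω : ℕ → Bool) (k n : ℕ) : List Bool :=
  (List.range n).map fun i => ω (k + i)

/-- `ω` is `α`-everywhere complex, complexity being measured by the decompressor `U`. -/
def IsEverywhereComplex (U : List Bool →. List Bool) (α : ℝ) (ω : ℕ → Bool) : Prop :=
  ∃ c : ℝ, ∀ k n : ℕ,
    ((α * n - c : ℝ) : EReal) ≤ ((complexity U (substring ω k n) : ℝ≥0∞) : EReal)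

/-- A probabilistic algorithm with a one-way, append-only output. Its configurations are coded by
natural numbers. In every step it receives a fresh bit of the random bit generator (which it may
ignore), passes to a new configuration, and appends finitely many bits (possibly none) to the
output; what it does is a computable function of the configuration and of the random bit. -/
structure ProbAlgorithm where
  init : ℕ
  step : ℕ → Bool → ℕ × List Bool
  computable_step : Computable₂ step

namespace ProbAlgorithm

/-- The pair (configuration, output so far) after `t` steps, when the random bits are `τ`. -/
def run (A : ProbAlgorithm) (τ : ℕ → Bool) : ℕ → ℕ × List Bool
  | 0 => (A.init, [])
  | t + 1 =>
    let s := run A τ t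
    let r := A.step s.1 (τ t)
    (r.1, s.2 ++ r.2)

/-- With random bits `τ`, the algorithm produces the infinite sequence `ω`: every term of `ω` is
eventually written at its place. (The output may also be finite; then no `ω` is produced.) -/
def Produces (A : ProbAlgorithm) (τ ω : ℕ → Bool) : Prop :=
  ∀ i : ℕ, ∃ t : ℕ, (A.run τ t).2[i]? = some (ω i)

end ProbAlgorithm

/-- The distribution of a sequence of independent fair random bits. -/
noncomputable def fairCoins : Measure (ℕ → Bool) :=
  Measure.infinitePi fun _ : ℕ => (PMF.uniformOfFintype Bool).toMeasure

/-- Splits `1^i 0 q` into `i` and `q`. -/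
def splitProgram (p : List Bool) : ℕ × List Bool :=
  ((p.takeWhile id).length, (p.dropWhile id).tail)

/-- Optimal decompressors exist. -/
theorem exists_isOptimal : ∃ U : List Bool →. List Bool, IsOptimal U := by
  let U : List Bool →. List Bool := fun p =>
    ((Denumerable.ofNat Nat.Partrec.Code (splitProgram p).1).eval
      (Encodable.encode (splitProgram p).2)).map fun m =>
        (Encodable.decode (α := List Bool) m).getD []
  have hsplit : Computable splitProgram :=
    (Primrec.pair
      (Primrec.list_length.comp (Primrec.list_takeWhile Primrec.id))
      (Primrec.list_tail.comp (Primrec.list_dropWhile Primrec.id))).to_comp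
  have hU : Partrec U := by
    refine Partrec.map (Nat.Partrec.Code.eval_part.comp
      ((Computable.ofNat _).comp (Computable.fst.comp hsplit))
      (Computable.encode.comp (Computable.snd.comp hsplit))) ?_
    exact Computable.option_getD (Computable.decode.comp Computable.snd) (Computable.const [])
  refine ⟨U, hU, fun D hD => ?_⟩
  obtain ⟨e, he⟩ := Nat.Partrec.Code.exists_code.1 hD
  refine ⟨Encodable.encode e + 1, fun x => ?_⟩
  unfold complexity
  rw [ENat.iInf_add]
  refine le_iInf fun q => ?_
  by_cases hq : x ∈ D q
  · have hs : splitProgram (List.replicate (Encodable.encode e) true ++ false :: q) =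
        (Encodable.encode e, q) := by
      simp [splitProgram]
    have hx : x ∈ U (List.replicate (Encodable.encode e) true ++ false :: q) := by
      simp only [U, hs, Denumerable.ofNat_encode, he, Part.mem_map_iff]
      exact ⟨Encodable.encode x, by simpa using hq, by simp⟩
    simp only [hq, iInf_pos]
    refine (iInf₂_le (f := fun (p : List Bool) (_ : x ∈ U p) => (p.length : ℕ∞)) _ hx).trans ?_
    simp only [List.length_append, List.length_replicate, List.length_cons]
    norm_cast
    omega
  · simp [hq]

end EverywhereComplex

namespace EverywhereComplex

/-! Let `p` be the probability of infinite output. For each `k` a computable search finds a list `F`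
of long words, the `i`-th word `y` having `i < 2 ^ (|y| / (2 * b))`, such that within a finite time
the output contains a word of `F` with probability at least `p - 3 / 2 ^ k`. The index describes `y`
in about half of `|y| / b` bits, so such an output violates the bound `|y| / b - c`. Any remaining
infinite output lies in an event of probability at most `4 / 2 ^ k` (`fairCoins_produces_eq_zero`),
and countably many pairs `(b, c)` cover all `α > 0` and all constants.

The core is combinatorial: `exists_hitting_list` finds `F` for any finite family of sufficiently
long words. Suppose all blocks of length `3 * b * u` lie in `W`, and group them by `q`. If some
group shows many distinct blocks, the word contains a sizable fraction of `W`, and a short greedily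
chosen list hits most such words. Otherwise every group is a concatenation of few distinct blocks;
such concatenations are so rare that the exponent of `|W|`, in units of `u`, drops by one at the
longer block length. After finitely many rounds all of `W` can be listed. -/

/-! ### Greedy covering -/

theorem two_mul_pow_le_succ_pow (r : ℕ) : 2 * r ^ (r + 1) ≤ (r + 1) ^ (r + 1) := by
  -- The two leading terms of the binomial expansion.
  have h : ∀ n : ℕ, r ^ (n + 1) + (n + 1) * r ^ n ≤ (r + 1) ^ (n + 1) := by
    intro n
    induction n with
    | zero => simp
    | succ n ih =>
      calc r ^ (n + 1 + 1) + (n + 1 + 1) * r ^ (n + 1)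
          ≤ (r ^ (n + 1) + (n + 1) * r ^ n) * (r + 1) := by
            have : (r ^ (n + 1) + (n + 1) * r ^ n) * (r + 1) =
              r ^ (n + 1 + 1) + (n + 1 + 1) * r ^ (n + 1) + (n + 1) * r ^ n := by ring
            omega
        _ ≤ (r + 1) ^ (n + 1) * (r + 1) := Nat.mul_le_mul_right _ ih
        _ = _ := (pow_succ _ _).symm
  refine le_trans ?_ (h r)
  have : (r + 1) * r ^ r = r ^ (r + 1) + r ^ r := by ring
  omega

/-- If every `x ∈ X` is incident to more than a `1 / R` fraction of `W`, some `L` elements of `W`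
leave at most a `(1 - 1 / R) ^ L` fraction of `X` unhit. -/
theorem exists_greedy_cover {ι β : Type*} (R : ℕ) (W : Finset β)
    (inc : ι → β → Prop) [∀ x y, Decidable (inc x y)] (L : ℕ) (X : Finset ι)
    (hX : ∀ x ∈ X, W.card < R * (W.filter (inc x)).card) :
    ∃ F : List β, F.length ≤ L ∧ (∀ y ∈ F, y ∈ W) ∧
      (X.filter fun x => ∀ y ∈ F, ¬ inc x y).card * R ^ L ≤ (R - 1) ^ L * X.card := by
  induction L generalizing X with
  | zero => exact ⟨[], by simp⟩
  | succ L ih =>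
    rcases X.eq_empty_or_nonempty with rfl | ⟨x₀, hx₀⟩
    · exact ⟨[], by simp⟩
    have hW : W.Nonempty := by
      rw [Finset.nonempty_iff_ne_empty]
      rintro rfl
      simpa using hX x₀ hx₀
    -- Double counting of incidences: on average `y ∈ W` hits at least `1 / R` of `X`, so some `y`
    -- does.
    have hsum : ∑ _y ∈ W, X.card ≤ ∑ y ∈ W, R * (X.filter fun x => inc x y).card := by
      have hdc := Finset.sum_card_bipartiteAbove_eq_sum_card_bipartiteBelow (s := X) (t := W) inc
      rw [← Finset.mul_sum]
      unfold Finset.bipartiteAbove Finset.bipartiteBelow at hdc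
      rw [← hdc, Finset.mul_sum, Finset.sum_const, smul_eq_mul, mul_comm, ← smul_eq_mul,
        ← Finset.sum_const]
      exact Finset.sum_le_sum fun x hx => (hX x hx).le
    obtain ⟨y, hy, hle⟩ := Finset.exists_le_of_sum_le hW hsum
    obtain ⟨F, hF, hFW, hc⟩ := ih (X.filter fun x => ¬ inc x y)
      fun x hx => hX x (Finset.mem_filter.1 hx).1
    refine ⟨y :: F, by simpa using hF, by simpa using ⟨hy, hFW⟩, ?_⟩
    have hfil : (X.filter fun x => ∀ z ∈ y :: F, ¬ inc x z) =
        (X.filter fun x => ¬ inc x y).filter fun x => ∀ z ∈ F, ¬ inc x z := by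
      ext x
      simp [and_assoc]
    rw [hfil]
    have hsplit := Finset.card_filter_add_card_filter_not (s := X) (fun x => inc x y)
    set a := (X.filter fun x => inc x y).card
    set c := (X.filter fun x => ¬ inc x y).card
    have hstep : c * R ≤ (R - 1) * X.card := by
      rcases R with _ | R
      · simp
      · rw [← hsplit] at hle ⊢
        simp only [Nat.add_sub_cancel]
        nlinarith
    calc _ ≤ ((R - 1) ^ L * c) * R := by
          rw [pow_succ, ← mul_assoc]
          exact Nat.mul_le_mul_right _ hc
      _ = (R - 1) ^ L * (c * R) := by ring
      _ ≤ (R - 1) ^ L * ((R - 1) * X.card) := Nat.mul_le_mul_left _ hstep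
      _ = _ := by ring

theorem exists_greedy_cover_two_pow {ι β : Type*} (r k : ℕ) (W : Finset β)
    (inc : ι → β → Prop) [∀ x y, Decidable (inc x y)] (X : Finset ι)
    (hX : ∀ x ∈ X, W.card < (r + 1) * (W.filter (inc x)).card) :
    ∃ F : List β, F.length ≤ (r + 1) * k ∧ (∀ y ∈ F, y ∈ W) ∧
      2 ^ k * (X.filter fun x => ∀ y ∈ F, ¬ inc x y).card ≤ X.card := by
  obtain ⟨F, hF, hFW, hc⟩ := exists_greedy_cover (r + 1) W inc ((r + 1) * k) X hX
  refine ⟨F, hF, hFW, ?_⟩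
  set a := (X.filter fun x => ∀ y ∈ F, ¬ inc x y).card
  rw [Nat.add_sub_cancel] at hc
  have h2 : 2 ^ k * r ^ ((r + 1) * k) ≤ (r + 1) ^ ((r + 1) * k) := by
    rw [pow_mul, pow_mul, ← mul_pow]
    exact Nat.pow_le_pow_left (two_mul_pow_le_succ_pow r) k
  have hpos : 0 < (r + 1) ^ ((r + 1) * k) := by positivity
  refine Nat.le_of_mul_le_mul_right ?_ hpos
  calc 2 ^ k * a * (r + 1) ^ ((r + 1) * k) = 2 ^ k * (a * (r + 1) ^ ((r + 1) * k)) := by ring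
    _ ≤ 2 ^ k * (r ^ ((r + 1) * k) * X.card) := Nat.mul_le_mul_left _ hc
    _ = (2 ^ k * r ^ ((r + 1) * k)) * X.card := by ring
    _ ≤ (r + 1) ^ ((r + 1) * k) * X.card := Nat.mul_le_mul_right _ h2
    _ = _ := mul_comm _ _

/-! ### Blocks and the hitting list -/

/-- The `i`-th block of length `n` of the word `x`. -/
def block (x : List Bool) (n i : ℕ) : List Bool := (x.drop (i * n)).take n

theorem block_infix (x : List Bool) (n i : ℕ) : block x n i <:+: x :=
  (List.take_prefix _ _).isInfix.trans (List.drop_suffix _ _).isInfix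

theorem block_mul (x : List Bool) (n q g : ℕ) :
    block x (q * n) g = (List.ofFn fun i : Fin q => block x n (g * q + i)).flatten := by
  have h : ∀ r, (x.drop (g * (q * n))).take (r * n) =
      (List.ofFn fun i : Fin r => block x n (g * q + i)).flatten := by
    intro r
    induction r with
    | zero => simp
    | succ r ih =>
      rw [List.ofFn_succ', List.concat_eq_append, List.flatten_append, add_mul, one_mul,
        List.take_add]
      simp only [Fin.val_castSucc, Fin.val_last]
      rw [← ih]
      simp only [block, List.drop_drop, List.flatten_cons, List.flatten_nil, List.append_nil]
      congr 3
      ring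
  exact h q

/-- The concatenations of `q` words from `W` among which at most `M` are distinct. -/
noncomputable def fewBlocks (W : Finset (List Bool)) (M q : ℕ) : Finset (List Bool) :=
  (Finset.univ : Finset ((Fin M → W) × (Fin q → Fin M))).image
    fun p => (List.ofFn fun i => (p.1 (p.2 i) : List Bool)).flatten

/-- A member is determined by a palette of `M` words and a palette index for each of the `q`
positions. -/
theorem card_fewBlocks_le (W : Finset (List Bool)) (M q : ℕ) :
    (fewBlocks W M q).card ≤ W.card ^ M * M ^ q :=
  Finset.card_image_le.trans (by simp)

theorem length_of_mem_fewBlocks {W : Finset (List Bool)} {M q n : ℕ}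
    (hW : ∀ y ∈ W, y.length = n) {y : List Bool} (hy : y ∈ fewBlocks W M q) :
    y.length = q * n := by
  obtain ⟨p, -, rfl⟩ := Finset.mem_image.1 hy
  simp [List.length_flatten, Function.comp_def, hW _ (p.1 _).2]

theorem mem_fewBlocks {W : Finset (List Bool)} {M q : ℕ} (hq : 0 < q)
    (f : Fin q → List Bool)     (hf : ∀ i, f i ∈ W) (hM : (Finset.univ.image f).card ≤ M) :
    (List.ofFn f).flatten ∈ fewBlocks W M q := by
  classical
  set S := Finset.univ.image f
  have hmem : ∀ i, f i ∈ S := fun i => Finset.mem_image_of_mem _ (Finset.mem_univ i)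
  let e := S.equivFin
  -- The palette enumerates the distinct values of `f`; its unused slots are filled with `f z`.
  let z : Fin q := ⟨0, hq⟩
  refine Finset.mem_image.2 ⟨⟨fun j => if h : (j : ℕ) < S.card then
    ⟨e.symm ⟨j, h⟩, ?_⟩ else ⟨f z, hf z⟩, fun i => Fin.castLE hM (e ⟨f i, hmem i⟩)⟩,
      Finset.mem_univ _, ?_⟩
  · obtain ⟨i, -, hi⟩ := Finset.mem_image.1 (e.symm ⟨j, h⟩).2
    exact hi ▸ hf i
  · simp

/-- Induction on `m`, which measures the size of `W`. The offset `o` reserves indices for words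
listed in earlier rounds. `N` is independent of `X`, so an algorithm can first be run until `N`
blocks are likely to be written. -/
theorem exists_hitting_list (b k : ℕ) (hb : 0 < b) (m : ℕ) :
    ∀ o L₀ : ℕ, ∃ u₀ : ℕ, ∀ u ≥ u₀, ∀ W : Finset (List Bool),
      (∀ y ∈ W, y.length = 3 * b * u) → W.card ≤ 2 ^ ((m + 2) * u) →
      ∃ N : ℕ, ∀ (ι : Type) (X : Finset ι) (w : ι → List Bool),
        (∀ x ∈ X, ∀ i < N, block (w x) (3 * b * u) i ∈ W) →
        ∃ F : List (List Bool),
          (∀ i (h : i < F.length), i + o < 2 ^ (F[i].length / b) ∧ L₀ ≤ F[i].length) ∧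
          2 ^ k * (X.filter fun x => ∀ y ∈ F, ¬ y <:+: w x).card ≤ X.card := by
  classical
  have hdiv : ∀ u, 3 * b * u / b = 3 * u := fun u => by
    rw [mul_comm 3 b, mul_assoc, Nat.mul_div_cancel_left _ hb]
  have hbound : ∀ o u : ℕ, o + k + 1 ≤ u → ∀ i ≤ 2 ^ (2 * u) * (k + 1),
      i + o < 2 ^ (3 * u) := by
    intro o u hu i hi
    have h1 : u < 2 ^ u := Nat.lt_two_pow_self
    have h2 : 2 ^ (3 * u) = 2 ^ (2 * u) * 2 ^ u := by rw [← pow_add]; congr 1; ring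
    have h3 : 1 ≤ 2 ^ (2 * u) := Nat.one_le_two_pow
    have h4 : i + o ≤ 2 ^ (2 * u) * u := by
      calc i + o ≤ 2 ^ (2 * u) * (k + 1) + 2 ^ (2 * u) * o := by nlinarith
        _ = 2 ^ (2 * u) * (o + k + 1) := by ring
        _ ≤ _ := Nat.mul_le_mul_left _ hu
    rw [h2]
    exact h4.trans_lt (Nat.mul_lt_mul_of_pos_left h1 (by omega))
  induction m with
  | zero =>
    intro o L₀
    refine ⟨o + k + L₀ + 1, fun u hu W hWl hWc => ⟨1, fun ι X w hw => ?_⟩⟩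
    -- Here `|W| ≤ 2 ^ (2 * u)`, so all of `W` fits below the index bound `2 ^ (3 * u)`, and the
    -- first block is a hit.
    refine ⟨W.toList, fun i hi => ?_, ?_⟩
    · have hl := hWl _ (Finset.mem_toList.1 (List.getElem_mem hi))
      rw [hl, hdiv]
      rw [Finset.length_toList] at hi
      refine ⟨hbound o u (by omega) i ?_, by nlinarith⟩
      rw [zero_add] at hWc
      nlinarith
    · rw [Finset.filter_eq_empty_iff.2]
      · simp
      · intro x hx h
        exact h _ (Finset.mem_toList.2 (hw x hx 0 one_pos)) (block_infix _ _ _)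
  | succ m ih =>
    intro o L₀
    refine ⟨o + k + L₀ + 1, fun u hu W hWl hWc => ?_⟩
    set M := 2 ^ ((m + 1) * u) with hM
    -- The greedy list for rich words uses at most `2 ^ (2 * u) * k` further indices.
    obtain ⟨u₁, hu₁⟩ := ih (o + 2 ^ (2 * u) * k) L₀
    -- Since `q ≥ (m + 3) * M`, the palette factor `|W| ^ M` costs at most one factor `2 ^ (q * u)`.
    set q := u₁ + (m + 3) * M with hq
    have hqu : u₁ ≤ q * u := by nlinarith
    have hqn : 3 * b * (q * u) = q * (3 * b * u) := by ring
    obtain ⟨N, hN⟩ := hu₁ (q * u) hqu (fewBlocks W M q)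
      (fun y hy => by rw [length_of_mem_fewBlocks hWl hy, hqn]) (by
        calc (fewBlocks W M q).card ≤ W.card ^ M * M ^ q := card_fewBlocks_le _ _ _
          _ ≤ (2 ^ ((m + 1 + 2) * u)) ^ M * M ^ q :=
            Nat.mul_le_mul_right _ (Nat.pow_le_pow_left hWc _)
          _ = 2 ^ ((m + 3) * M * u + (m + 1) * (q * u)) := by
            rw [hM, ← pow_mul, ← pow_mul, ← pow_add]; ring_nf
          _ ≤ 2 ^ ((m + 2) * (q * u)) := by
            apply Nat.pow_le_pow_right (by norm_num)
            have : (m + 3) * M * u ≤ q * u := Nat.mul_le_mul_right _ (by omega)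
            nlinarith)
    refine ⟨N * q, fun ι X w hw => ?_⟩
    have hL : L₀ ≤ 3 * b * u := by nlinarith
    set n := 3 * b * u
    let rich : ι → Prop := fun x => ∃ g < N,
      M < (Finset.univ.image fun i : Fin q => block (w x) n (g * q + i)).card
    have hblk : ∀ x ∈ X, ∀ g < N, ∀ i : Fin q, block (w x) n (g * q + i) ∈ W := by
      intro x hx g hg i
      refine hw x hx _ ?_
      have := i.2
      nlinarith
    obtain ⟨F₂, hF₂, hc₂⟩ := hN ι (X.filter fun x => ¬ rich x) w (by
      intro x hx g hg
      obtain ⟨hxX, hr⟩ := Finset.mem_filter.1 hx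
      rw [hqn, block_mul]
      refine mem_fewBlocks (by positivity) _ (hblk x hxX g hg) ?_
      by_contra h
      exact hr ⟨g, hg, not_le.1 h⟩)
    -- A rich word contains more than `M ≥ |W| / 2 ^ (2 * u)` words of `W`.
    obtain ⟨F₁, hF₁, hFW, hc₁⟩ := exists_greedy_cover_two_pow (2 ^ (2 * u) - 1) k W
      (fun x y => y <:+: w x) (X.filter rich) (by
        intro x hx
        obtain ⟨hxX, g, hg, hgM⟩ := Finset.mem_filter.1 hx
        rw [Nat.sub_add_cancel Nat.one_le_two_pow]
        calc W.card ≤ 2 ^ ((m + 1 + 2) * u) := hWc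
          _ = 2 ^ (2 * u) * M := by rw [hM, ← pow_add]; ring_nf
          _ < 2 ^ (2 * u) * (Finset.univ.image fun i : Fin q => block (w x) n (g * q + i)).card :=
            Nat.mul_lt_mul_of_pos_left hgM (by positivity)
          _ ≤ _ := by
            refine Nat.mul_le_mul_left _ (Finset.card_le_card ?_)
            intro y hy
            obtain ⟨i, -, rfl⟩ := Finset.mem_image.1 hy
            exact Finset.mem_filter.2 ⟨hblk x hxX g hg i, block_infix _ _ _⟩)
    rw [Nat.sub_add_cancel Nat.one_le_two_pow] at hF₁
    refine ⟨F₁ ++ F₂, fun i hi => ?_, ?_⟩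
    · rw [List.getElem_append]
      split_ifs with h
      · rw [hWl _ (hFW _ (List.getElem_mem h)), hdiv]
        refine ⟨hbound o u (by omega) i (by rw [mul_add]; omega), hL⟩
      · rw [List.length_append] at hi
        have := hF₂ (i - F₁.length) (by omega)
        exact ⟨by omega, this.2⟩
    · have hsplit := Finset.card_filter_add_card_filter_not (s := X) rich
      have hle : (X.filter fun x => ∀ y ∈ F₁ ++ F₂, ¬ y <:+: w x).card ≤
          ((X.filter rich).filter fun x => ∀ y ∈ F₁, ¬ y <:+: w x).card +
          ((X.filter fun x => ¬ rich x).filter fun x => ∀ y ∈ F₂, ¬ y <:+: w x).card := by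
        refine (Finset.card_le_card ?_).trans (Finset.card_union_le _ _)
        intro x hx
        obtain ⟨hxX, hx⟩ := Finset.mem_filter.1 hx
        by_cases hr : rich x
        · exact Finset.mem_union_left _ (by
            simp only [Finset.mem_filter]
            exact ⟨⟨hxX, hr⟩, fun y hy => hx y (List.mem_append_left _ hy)⟩)
        · exact Finset.mem_union_right _ (by
            simp only [Finset.mem_filter]
            exact ⟨⟨hxX, hr⟩, fun y hy => hx y (List.mem_append_right _ hy)⟩)
      calc _ ≤ 2 ^ k * (_ + _) := Nat.mul_le_mul_left _ hle
        _ ≤ _ := by rw [mul_add]; omega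

/-! ### Fair coins and finite runs -/

instance : IsProbabilityMeasure fairCoins := by
  unfold fairCoins
  infer_instance

/-- An event depending only on the bits before time `t` is independent of bit `t`. -/
theorem fairCoins_real_inter_eval {t : ℕ} {S : Set (ℕ → Bool)}
    (hS : ∀ τ τ' : ℕ → Bool, (∀ i < t, τ i = τ' i) → τ ∈ S → τ' ∈ S) (b : Bool) :
    MeasurableSet S ∧ fairCoins.real (S ∩ {τ | τ t = b}) = fairCoins.real S / 2 := by
  classical
  let R : Finset ℕ := Finset.range t
  let ext : (R → Bool) → ℕ → Bool := fun σ i => if h : i ∈ R then σ ⟨i, h⟩ else false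
  let S' : Set (R → Bool) := {σ | ext σ ∈ S}
  have hSS' : S = (fun (τ : ℕ → Bool) (i : R) => τ i) ⁻¹' S' := by
    ext τ
    have h : ∀ i < t, τ i = ext (fun i : R => τ i) i := fun i hi => by simp [ext, R, hi]
    exact ⟨hS _ _ h, hS _ _ fun i hi => (h i hi).symm⟩
  have hmS' : MeasurableSet S' := S'.toFinite.measurableSet
  have hmeas : ∀ i : ℕ, Measurable fun τ : ℕ → Bool => τ i := fun i => measurable_pi_apply i
  have hind := (ProbabilityTheory.iIndepFun_infinitePi
      (P := fun _ : ℕ => (PMF.uniformOfFintype Bool).toMeasure)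
      (X := fun _ b => b) (fun _ => measurable_id)).indepFun_finset R {t}
      (by simp [R]) hmeas
  have hprob : fairCoins {τ | τ t = b} = 1 / 2 := by
    have h := Measure.infinitePi_map_eval
      (fun _ : ℕ => (PMF.uniformOfFintype Bool).toMeasure) t
    have h' := congrArg (fun m => m {b}) h
    rw [Measure.map_apply (hmeas t) (measurableSet_singleton b)] at h'
    refine h'.trans ?_
    rw [PMF.toMeasure_apply_singleton _ _ (measurableSet_singleton b)]
    simp
  refine ⟨hSS' ▸ hmS'.preimage (by fun_prop), ?_⟩
  have hb : {τ : ℕ → Bool | τ t = b} =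
      (fun (τ : ℕ → Bool) (i : ({t} : Finset ℕ)) => τ i) ⁻¹'
        {σ | σ ⟨t, Finset.mem_singleton_self t⟩ = b} := rfl
  have h := hind.measure_inter_preimage_eq_mul S'
    {σ | σ ⟨t, Finset.mem_singleton_self t⟩ = b} hmS' (Set.toFinite _).measurableSet
  rw [← hb, ← hSS'] at h
  change fairCoins _ = fairCoins _ * fairCoins _ at h
  rw [Measure.real, h, hprob, ENNReal.toReal_mul]
  simp [Measure.real, div_eq_mul_inv]

namespace ProbAlgorithm

variable (A : ProbAlgorithm)

/-- One step of the algorithm on a pair (configuration, output so far). -/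
def next (s : ℕ × List Bool) (b : Bool) : ℕ × List Bool :=
  ((A.step s.1 b).1, s.2 ++ (A.step s.1 b).2)

theorem run_succ (τ : ℕ → Bool) (t : ℕ) : A.run τ (t + 1) = A.next (A.run τ t) (τ t) := rfl

theorem run_congr {τ τ' : ℕ → Bool} (t : ℕ) (h : ∀ i < t, τ i = τ' i) :
    A.run τ t = A.run τ' t := by
  induction t with
  | zero => rfl
  | succ t ih => rw [run_succ, run_succ, ih fun i hi => h i (by omega), h t (by omega)]

theorem run_prefix (τ : ℕ → Bool) {t t' : ℕ} (h : t ≤ t') :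
    (A.run τ t).2 <+: (A.run τ t').2 := by
  induction t', h using Nat.le_induction with
  | base => exact List.prefix_rfl
  | succ n _ ih => exact ih.trans (List.prefix_append _ _)

/-- The results of all `2 ^ t` computations of length `t`. -/
def outcomes : ℕ → List (ℕ × List Bool)
  | 0 => [(A.init, [])]
  | t + 1 => (outcomes t).flatMap fun s => [A.next s false, A.next s true]

theorem countP_outcomes_succ (p : ℕ × List Bool → Bool) (t : ℕ) :
    (A.outcomes (t + 1)).countP p = (A.outcomes t).countP (fun s => p (A.next s false)) +
      (A.outcomes t).countP (fun s => p (A.next s true)) := by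
  simp only [outcomes]
  induction A.outcomes t with
  | nil => rfl
  | cons s l ih =>
    simp only [List.flatMap_cons, List.countP_append, ih, List.countP_cons, List.countP_nil]
    omega

theorem measurableSet_run (p : ℕ × List Bool → Bool) (t : ℕ) :
    MeasurableSet {τ | p (A.run τ t) = true} :=
  (fairCoins_real_inter_eval (t := t) (fun τ τ' h hτ => by
    rw [Set.mem_ofPred_eq, ← A.run_congr t h]
    exact hτ) true).1

/-- Conditioning on the last bit absorbs the last step into the predicate, hence the induction over
all `p`. This turns probabilities into computable counts. -/
theorem fairCoins_real_run (p : ℕ × List Bool → Bool) (t : ℕ) :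
    fairCoins.real {τ | p (A.run τ t) = true} * 2 ^ t = (A.outcomes t).countP p := by
  induction t generalizing p with
  | zero =>
    by_cases h : p (A.init, []) = true <;> simp [run, outcomes, h]
  | succ t ih =>
    have hb : ∀ b : Bool, fairCoins.real ({τ | p (A.next (A.run τ t) b) = true} ∩
        {τ | τ t = b}) = fairCoins.real {τ | p (A.next (A.run τ t) b) = true} / 2 := fun b =>
      (fairCoins_real_inter_eval (t := t) (fun τ τ' h hτ => by
        rw [Set.mem_ofPred_eq, ← A.run_congr t h]
        exact hτ) b).2
    have hu : {τ | p (A.run τ (t + 1)) = true} =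
        ({τ | p (A.next (A.run τ t) false) = true} ∩ {τ | τ t = false}) ∪
        ({τ | p (A.next (A.run τ t) true) = true} ∩ {τ | τ t = true}) := by
      ext τ
      rcases h : τ t <;> simp [run_succ, h]
    rw [hu, measureReal_union, hb, hb, countP_outcomes_succ, Nat.cast_add, ← ih, ← ih, pow_succ]
    · ring
    · refine Set.disjoint_left.2 fun τ h h' => ?_
      have h1 := h.2
      have h2 := h'.2
      simp_all
    · exact (A.measurableSet_run (fun s => p (A.next s true)) t).inter
        (measurableSet_eq_fun (measurable_pi_apply t) measurable_const)

end ProbAlgorithm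

/-! ### Computability of the search -/

theorem primrec_two_pow : Primrec fun n : ℕ => 2 ^ n :=
  (Primrec.nat_rec₁ 1 (Primrec.nat_mul.comp (Primrec.const 2) Primrec.snd).to₂).of_eq
    fun n => by induction n <;> simp_all [pow_succ, mul_comm]

theorem isInfix_iff_exists_take_drop {α : Type*} (y x : List α) :
    y <:+: x ↔ ∃ k ∈ List.range (x.length + 1), (x.drop k).take y.length = y := by
  constructor
  · rintro ⟨s, t, rfl⟩
    exact ⟨s.length, by simp, by simp⟩
  · rintro ⟨k, -, h⟩
    rw [← h]
    exact (List.take_prefix _ _).isInfix.trans (List.drop_suffix _ _).isInfix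

theorem primrecRel_isInfix : PrimrecRel fun y x : List Bool => y <:+: x := by
  have h : PrimrecRel fun (k : ℕ) (p : List Bool × List Bool) =>
      (p.2.drop k).take p.1.length = p.1 :=
    Primrec.eq.comp
      (Primrec.list_take.comp (Primrec.list_length.comp (Primrec.fst.comp Primrec.snd))
        (Primrec.list_drop.comp Primrec.fst (Primrec.snd.comp Primrec.snd)))
      (Primrec.fst.comp Primrec.snd)
  exact (h.exists_mem_list.comp
    (Primrec.list_range.comp (Primrec.succ.comp (Primrec.list_length.comp Primrec.snd)))
    Primrec.id).of_eq fun p => (isInfix_iff_exists_take_drop _ _).symm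

/-- A fold is a recursion on the position in the list, reading one entry per step. -/
theorem computable_list_foldl {α β σ : Type*} [Primcodable α] [Primcodable β] [Primcodable σ]
    {f : α → List β} {g : α → σ} {h : α → σ × β → σ} (hf : Computable f) (hg : Computable g)
    (hh : Computable₂ h) : Computable fun a => (f a).foldl (fun s b => h a (s, b)) (g a) := by
  have hstep : Computable₂ fun (a : α) (p : ℕ × σ) =>
      Option.casesOn (motive := fun _ => σ) ((f a)[p.1]?) p.2 fun b => h a (p.2, b) :=
    Computable.option_casesOn
      (Computable.list_getElem?.comp (hf.comp Computable.fst)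
        (Computable.fst.comp Computable.snd))
      (Computable.snd.comp Computable.snd)
      (hh.comp (Computable.fst.comp Computable.fst)
        (Computable.pair (Computable.snd.comp (Computable.snd.comp Computable.fst))
          Computable.snd)).to₂
  refine (Computable.nat_rec (Computable.list_length.comp hf) hg hstep).of_eq fun a => ?_
  have key : ∀ n ≤ (f a).length, Nat.rec (motive := fun _ => σ) (g a)
      (fun y IH => Option.casesOn (motive := fun _ => σ) ((f a)[y]?) IH fun b => h a (IH, b)) n =
      ((f a).take n).foldl (fun s b => h a (s, b)) (g a) := by
    intro n
    induction n with
    | zero => simp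
    | succ n ih =>
      intro hn
      rw [List.take_add_one, List.foldl_append, ← ih (by omega)]
      simp [List.getElem?_eq_getElem (show n < (f a).length by omega)]
  simpa using key _ le_rfl

theorem computable_outcomes (A : ProbAlgorithm) : Computable A.outcomes := by
  have hnext : Computable₂ A.next := by
    have hs : Computable fun p : (ℕ × List Bool) × Bool => A.step p.1.1 p.2 :=
      A.computable_step.comp (Computable.fst.comp Computable.fst) Computable.snd
    exact Computable.pair (Computable.fst.comp hs)
      (Computable.list_append.comp (Computable.snd.comp Computable.fst)
        (Computable.snd.comp hs))
  have hfold : Computable fun l : List (ℕ × List Bool) => l.foldl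
      (fun (acc : List (ℕ × List Bool)) s => acc ++ [A.next s false, A.next s true]) [] := by
    have hn : ∀ b : Bool, Computable
        fun p : List (ℕ × List Bool) × (List (ℕ × List Bool) × (ℕ × List Bool)) =>
          A.next p.2.2 b := fun b =>
      hnext.comp (Computable.snd.comp Computable.snd) (Computable.const b)
    exact computable_list_foldl
      (h := fun (_ : List (ℕ × List Bool)) (p : List (ℕ × List Bool) × (ℕ × List Bool)) =>
        p.1 ++ [A.next p.2 false, A.next p.2 true])
      Computable.id (Computable.const [])
      (Computable.list_append.comp (Computable.fst.comp Computable.snd)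
        (Computable.list_cons.comp (hn false)
          (Computable.list_cons.comp (hn true) (Computable.const []))))
  refine (Computable.nat_rec (f := fun t : ℕ => t) (g := fun _ => [(A.init, [])])
    (h := fun _ p => p.2.foldl
      (fun (acc : List (ℕ × List Bool)) s => acc ++ [A.next s false, A.next s true]) [])
    Computable.id (Computable.const _)
    (hfold.comp (Computable.snd.comp Computable.snd)).to₂).of_eq fun t => ?_
  induction t with
  | zero => rfl
  | succ t ih =>
    simp only [ih, ProbAlgorithm.outcomes]
    have key : ∀ (l acc : List (ℕ × List Bool)), l.foldl
        (fun acc s => acc ++ [A.next s false, A.next s true]) acc =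
        acc ++ l.flatMap fun s => [A.next s false, A.next s true] := by
      intro l
      induction l with
      | nil => simp
      | cons s l ihl =>
        intro acc
        rw [List.foldl_cons, ihl, List.flatMap_cons, List.append_assoc]
    rw [key, List.nil_append]

/-- Some word of `F` occurs in `x`. -/
abbrev Hits (F : List (List Bool)) (x : List Bool) : Prop := ∃ y ∈ F, y <:+: x

/-- The number of results of length-`t` computations whose output contains a word of `F`. -/
def hitCount (A : ProbAlgorithm) (F : List (List Bool)) (t : ℕ) : ℕ :=
  (A.outcomes t).countP fun s => decide (Hits F s.2)

theorem computable_hitCount (A : ProbAlgorithm) :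
    Computable fun p : List (List Bool) × ℕ => hitCount A p.1 p.2 := by
  have h1 : PrimrecRel fun (s : ℕ × List Bool) (F : List (List Bool)) => Hits F s.2 :=
    primrecRel_isInfix.exists_mem_list.comp Primrec.snd (Primrec.snd.comp Primrec.fst)
  have h2 : Primrec₂ fun (l : List (ℕ × List Bool)) (F : List (List Bool)) =>
      (l.filter fun s => decide (Hits F s.2)).length :=
    Primrec.list_length.comp h1.listFilter
  refine (h2.to_comp.comp ((computable_outcomes A).comp Computable.snd) Computable.fst).of_eq
    fun p => ?_
  simp [hitCount, List.countP_eq_length_filter]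

/-- The words of `F` have length at least `L`, and the `i`-th word `y` satisfies
`i < 2 ^ (|y| / b)`. -/
abbrev IsSparse (b L : ℕ) (F : List (List Bool)) : Prop :=
  ∀ i ∈ List.range F.length, i < 2 ^ ((F.getD i []).length / b) ∧ L ≤ (F.getD i []).length

theorem primrecPred_isSparse (b : ℕ) :
    PrimrecPred fun p : ℕ × List (List Bool) => IsSparse b p.1 p.2 := by
  have hl : Primrec fun q : ℕ × (ℕ × List (List Bool)) => (q.2.2.getD q.1 []).length :=
    Primrec.list_length.comp ((Primrec.list_getD []).comp (Primrec.snd.comp Primrec.snd)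
      Primrec.fst)
  have h : PrimrecRel fun (i : ℕ) (p : ℕ × List (List Bool)) =>
      i < 2 ^ ((p.2.getD i []).length / b) ∧ p.1 ≤ (p.2.getD i []).length :=
    (Primrec.nat_lt.comp Primrec.fst (primrec_two_pow.comp
      (Primrec.nat_div.comp hl (Primrec.const b)))).and
      (Primrec.nat_le.comp (Primrec.fst.comp Primrec.snd) hl)
  exact h.forall_mem_list.comp
    (Primrec.list_range.comp (Primrec.list_length.comp Primrec.snd)) Primrec.id

/-- A computable relation all of whose sections are nonempty has a computable choice function. -/
theorem exists_computable_choice {α : Type*} [Primcodable α] [Inhabited α] {q : ℕ → α → Bool}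
    (hq : Computable₂ q) (hex : ∀ s, ∃ a, q s a = true) :
    ∃ f : ℕ → α, Computable f ∧ ∀ s, q s (f s) = true := by
  -- Unbounded search over codes; a number coding nothing counts as a failure.
  have hc : Computable₂ fun s n : ℕ => ((Encodable.decode (α := α) n).map (q s)).getD false :=
    Computable.option_getD
      (Computable.option_map (Computable.decode.comp Computable.snd)
        (hq.comp (Computable.fst.comp Computable.fst) Computable.snd).to₂)
      (Computable.const false)
  have hr := Partrec.rfind hc.partrec₂
  have hdom : ∀ s, ∃ n, n ∈ Nat.rfind
      fun n => (Part.some (((Encodable.decode (α := α) n).map (q s)).getD false)) := by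
    intro s
    obtain ⟨a, ha⟩ := hex s
    obtain ⟨n, hn, -⟩ := Nat.rfind_min'
      (p := fun n => ((Encodable.decode (α := α) n).map (q s)).getD false)
      (m := Encodable.encode a) (by simp [ha])
    exact ⟨n, hn⟩
  choose g hg using hdom
  have hgc : Computable g := by
    refine Partrec.of_eq hr fun s => ?_
    exact Part.eq_some_iff.2 (hg s)
  refine ⟨fun s => (Encodable.decode (α := α) (g s)).getD default,
    Computable.option_getD (Computable.decode.comp hgc) (Computable.const _), fun s => ?_⟩
  have h := Nat.rfind_spec (hg s)
  rw [Part.mem_some_iff] at h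
  rcases hd : Encodable.decode (α := α) (g s) with _ | a <;> simp_all

theorem card_filter_get {α : Type*} (l : List α) (p : α → Bool) :
    (Finset.univ.filter fun i : Fin l.length => p (l.get i) = true).card = l.countP p := by
  have h : (Finset.univ : Finset (Fin l.length)).val.map l.get = (l : Multiset α) := by
    rw [Fin.univ_val_map, List.ofFn_get]
  have h' : l.countP p = (l : Multiset α).countP fun a => p a = true := by
    simp [Multiset.coe_countP]
  rw [h', ← h, Multiset.countP_map]
  rfl

/-! ### Infinite output and hitting it in finite time -/

namespace ProbAlgorithm

variable (A : ProbAlgorithm)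

/-- The event that at least `N` bits are eventually output. -/
def outputsAtLeast (N : ℕ) : Set (ℕ → Bool) := {τ | ∃ t, N ≤ (A.run τ t).2.length}

/-- The event that the output is infinite. -/
def outputsInfinite : Set (ℕ → Bool) := ⋂ N, A.outputsAtLeast N

theorem measurableSet_length_run (N t : ℕ) :
    MeasurableSet {τ | N ≤ (A.run τ t).2.length} := by
  simpa using A.measurableSet_run (fun s => decide (N ≤ s.2.length)) t

theorem outputsAtLeast_eq_iUnion (N : ℕ) :
    A.outputsAtLeast N = ⋃ t, {τ | N ≤ (A.run τ t).2.length} := by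
  ext τ
  simp [outputsAtLeast]

theorem measurableSet_outputsAtLeast (N : ℕ) : MeasurableSet (A.outputsAtLeast N) := by
  rw [outputsAtLeast_eq_iUnion]
  exact MeasurableSet.iUnion fun t => A.measurableSet_length_run N t

theorem exists_time_of_lt_outputsInfinite (N : ℕ) {r : ℝ}
    (hr : r < fairCoins.real A.outputsInfinite) :
    ∃ t, r < fairCoins.real {τ | N ≤ (A.run τ t).2.length} := by
  have hmono : Monotone fun t => {τ | N ≤ (A.run τ t).2.length} := fun t t' h τ hτ =>
    le_trans (show N ≤ _ from hτ) (A.run_prefix τ h).length_le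
  have hlim := tendsto_measure_iUnion_atTop (μ := fairCoins) hmono
  rw [← outputsAtLeast_eq_iUnion] at hlim
  have hlim' := (ENNReal.tendsto_toReal (measure_ne_top _ _)).comp hlim
  have hle : fairCoins.real A.outputsInfinite ≤ fairCoins.real (A.outputsAtLeast N) :=
    measureReal_mono (Set.iInter_subset _ N)
  exact (hlim'.eventually (lt_mem_nhds (hr.trans_le hle))).exists

theorem exists_outputsAtLeast_lt {r : ℝ} (hr : fairCoins.real A.outputsInfinite < r) :
    ∃ N, fairCoins.real (A.outputsAtLeast N) < r := by
  have hanti : Antitone A.outputsAtLeast := fun N N' h τ ⟨t, ht⟩ => ⟨t, h.trans ht⟩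
  have hlim := tendsto_measure_iInter_atTop (μ := fairCoins)
    (fun N => (A.measurableSet_outputsAtLeast N).nullMeasurableSet) hanti
    ⟨0, measure_ne_top _ _⟩
  have hlim' := (ENNReal.tendsto_toReal (measure_ne_top _ _)).comp hlim
  exact (hlim'.eventually (gt_mem_nhds hr)).exists

end ProbAlgorithm

/-- For some time `t`, all but a `2 ^ (1 - k)` part of the probability of an infinite output is hit
by a sparse list of long words. -/
theorem exists_isSparse_hitCount (A : ProbAlgorithm) (b L k : ℕ) (hb : 0 < b) :
    ∃ F t, IsSparse b L F ∧
      ⌈fairCoins.real A.outputsInfinite * 2 ^ k⌉₊ * 2 ^ t ≤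
        2 ^ k * hitCount A F t + 3 * 2 ^ t := by
  classical
  -- With `m = 3 * b` the size bound admits all `2 ^ (3 * b * u)` words of the block length.
  obtain ⟨u, hu⟩ := exists_hitting_list b k hb (3 * b) 0 L
  set n := 3 * b * u with hn
  let W : Finset (List Bool) := (Finset.univ : Finset (Fin n → Bool)).image List.ofFn
  have hW : ∀ y : List Bool, y.length = n → y ∈ W := by
    intro y hy
    exact Finset.mem_image.2 ⟨fun i => y.get (i.cast hy.symm), Finset.mem_univ _,
      List.ext_getElem (by simp [hy]) (by simp)⟩
  obtain ⟨N, hN⟩ := hu u le_rfl W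
    (fun y hy => by
      obtain ⟨f, -, rfl⟩ := Finset.mem_image.1 hy
      simp [hn])
    (Finset.card_image_le.trans (by
      simp only [Finset.card_univ, Fintype.card_fun, Fintype.card_bool, Fintype.card_fin]
      exact Nat.pow_le_pow_right (by norm_num) (Nat.mul_le_mul_right _ (by omega))))
  have hlt : fairCoins.real A.outputsInfinite - 1 / 2 ^ k < fairCoins.real A.outputsInfinite :=
    sub_lt_self _ (by positivity)
  obtain ⟨t, ht⟩ := A.exists_time_of_lt_outputsInfinite (N * n) hlt
  set l := A.outcomes t
  obtain ⟨F, hF, hc⟩ := hN (Fin l.length)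
    (Finset.univ.filter fun i => decide (N * n ≤ (l.get i).2.length) = true)
    (fun i => (l.get i).2) (by
      intro i hi j hj
      have hi := of_decide_eq_true (Finset.mem_filter.1 hi).2
      refine hW _ ?_
      have : (j + 1) * n ≤ N * n := Nat.mul_le_mul_right _ hj
      rw [add_mul, one_mul] at this
      rw [block, List.length_take, List.length_drop, ← hn]
      omega)
  refine ⟨F, t, fun i hi => ?_, ?_⟩
  · have hi := List.mem_range.1 hi
    rw [List.getD_eq_getElem _ _ hi]
    exact hF i hi
  have hprob := A.fairCoins_real_run (fun s => decide (N * n ≤ s.2.length)) t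
  have hcX := card_filter_get l fun s => decide (N * n ≤ s.2.length)
  have hcH := card_filter_get l fun s => decide (Hits F s.2)
  set X := Finset.univ.filter fun i : Fin l.length => decide (N * n ≤ (l.get i).2.length) = true
  rw [← hcX] at hprob
  simp only [decide_eq_true_eq] at hprob
  have hle : X.card ≤ hitCount A F t +
      (X.filter fun i => ∀ y ∈ F, ¬ y <:+: (l.get i).2).card := by
    rw [hitCount, ← hcH]
    refine (Finset.card_le_card fun i hi => ?_).trans (Finset.card_union_le _ _)
    by_cases h : Hits F (l.get i).2
    · exact Finset.mem_union_left _ (Finset.mem_filter.2 ⟨Finset.mem_univ _, decide_eq_true h⟩)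
    · refine Finset.mem_union_right _ (Finset.mem_filter.2 ⟨hi, fun y hy hyi => h ⟨y, hy, hyi⟩⟩)
  have hceil := Nat.ceil_lt_add_one (a := fairCoins.real A.outputsInfinite * 2 ^ k)
    (by positivity)
  have h1 : fairCoins.real {τ | N * n ≤ (A.run τ t).2.length} ≤ 1 := measureReal_le_one
  set P := fairCoins.real {τ | N * n ≤ (A.run τ t).2.length}
  set p := fairCoins.real A.outputsInfinite
  set Q := (X.filter fun i => ∀ y ∈ F, ¬ y <:+: (l.get i).2).card
  have hk : (0 : ℝ) < 2 ^ k := by positivity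
  have htp : (0 : ℝ) < 2 ^ t := by positivity
  have hpP : p * 2 ^ k - 1 < P * 2 ^ k := by
    have := mul_lt_mul_of_pos_right ht hk
    rwa [sub_mul, one_div, inv_mul_cancel₀ hk.ne'] at this
  have hc' : (2 : ℝ) ^ k * Q ≤ X.card := by exact_mod_cast hc
  have hle' : (X.card : ℝ) ≤ hitCount A F t + Q := by exact_mod_cast hle
  -- One `2 ^ t` each for rounding up, for stopping at time `t`, and for the long outputs that `F`
  -- misses.
  have hgoal : (⌈p * 2 ^ k⌉₊ : ℝ) * 2 ^ t ≤ 2 ^ k * hitCount A F t + 3 * 2 ^ t := by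
    have e1 : (⌈p * 2 ^ k⌉₊ : ℝ) * 2 ^ t ≤ (P * 2 ^ k + 2) * 2 ^ t :=
      mul_le_mul_of_nonneg_right (by linarith) htp.le
    have e2 : (2 : ℝ) ^ k * X.card ≤ 2 ^ k * hitCount A F t + 2 ^ k * Q := by
      rw [← mul_add]
      exact mul_le_mul_of_nonneg_left hle' hk.le
    have e3 : (X.card : ℝ) ≤ 2 ^ t := by
      rw [← hprob]
      exact mul_le_of_le_one_left htp.le h1
    have e4 : (P * 2 ^ k + 2) * 2 ^ t = 2 ^ k * (X.card : ℝ) + 2 * 2 ^ t := by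
      rw [← hprob]
      ring
    linarith
  exact_mod_cast hgoal

/-! ### Short descriptions and the conclusion -/

/-- The number whose binary digits, the least significant first, are `q`. -/
def binaryValue (q : List Bool) : ℕ := q.foldr (fun b n => n * 2 + b.toNat) 0

theorem exists_binaryValue_eq (L i : ℕ) (hi : i < 2 ^ L) :
    ∃ q, q.length = L ∧ binaryValue q = i := by
  induction L generalizing i with
  | zero => exact ⟨[], rfl, by simp at hi; simp [binaryValue, hi]⟩
  | succ L ih =>
    obtain ⟨q, hq, hv⟩ := ih (i / 2) (by rw [pow_succ] at hi; omega)
    refine ⟨decide (i % 2 = 1) :: q, by simp [hq], ?_⟩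
    have : binaryValue (decide (i % 2 = 1) :: q) =
      binaryValue q * 2 + (decide (i % 2 = 1)).toNat := rfl
    rw [this, hv]
    by_cases h : i % 2 = 1
    · simp [h]; omega
    · simp [h]; omega

theorem primrec_binaryValue : Primrec binaryValue :=
  Primrec.list_foldr Primrec.id (Primrec.const 0)
    (Primrec.nat_add.comp
      (Primrec.nat_mul.comp (Primrec.snd.comp Primrec.snd) (Primrec.const 2))
      ((Primrec.dom_bool Bool.toNat).comp (Primrec.fst.comp Primrec.snd))).to₂

theorem primrec_splitProgram : Primrec splitProgram :=
  Primrec.pair (Primrec.list_length.comp (Primrec.list_takeWhile Primrec.id))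
    (Primrec.list_tail.comp (Primrec.list_dropWhile Primrec.id))

theorem complexity_le {D : List Bool →. List Bool} {p x : List Bool} (h : x ∈ D p) :
    complexity D x ≤ p.length :=
  iInf₂_le (f := fun (p : List Bool) (_ : x ∈ D p) => (p.length : ℕ∞)) p h

/-- The words of computable sparse lists have low complexity. -/
theorem exists_complexity_le_of_isSparse {U : List Bool →. List Bool} (hU : IsOptimal U)
    {f : ℕ → List (List Bool)} (hf : Computable f) :
    ∃ d : ℕ, ∀ b L s, IsSparse b L (f s) → ∀ y ∈ f s,
      complexity U y ≤ (s + y.length / b + d : ℕ) := by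
  -- A program is `s` in unary, a separator, and the index in the list `f s`, padded to `|y| / b`
  -- binary digits.
  let D : List Bool →. List Bool := fun p =>
    ((f (splitProgram p).1)[binaryValue (splitProgram p).2]? : Option (List Bool))
  have hD : Partrec D := Computable.ofOption (Computable.list_getElem?.comp
    (hf.comp (Computable.fst.comp primrec_splitProgram.to_comp))
    (primrec_binaryValue.to_comp.comp (Computable.snd.comp primrec_splitProgram.to_comp)))
  obtain ⟨c, hc⟩ := hU.le_add D hD
  refine ⟨c + 1, fun b L s hs y hy => ?_⟩
  obtain ⟨i, hi, rfl⟩ := List.getElem_of_mem hy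
  have hlt := (hs i (List.mem_range.2 hi)).1
  rw [List.getD_eq_getElem _ _ hi] at hlt
  obtain ⟨q, hq, hv⟩ := exists_binaryValue_eq _ _ hlt
  have hsp : splitProgram (List.replicate s true ++ false :: q) = (s, q) := by
    simp [splitProgram]
  have hmem : (f s)[i] ∈ D (List.replicate s true ++ false :: q) := by
    simp [D, hsp, hv, hi]
  refine (hc _).trans ((add_le_add_left (complexity_le hmem) _).trans ?_)
  simp only [List.length_append, List.length_replicate, List.length_cons, hq]
  norm_cast
  omega

theorem ProbAlgorithm.Produces.eq_substring {A : ProbAlgorithm} {τ ω : ℕ → Bool}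
    (h : A.Produces τ ω) {t : ℕ} {y : List Bool} (hy : y <:+: (A.run τ t).2) :
    ∃ j, y = substring ω j y.length := by
  have hget : ∀ i (hi : i < (A.run τ t).2.length), (A.run τ t).2[i] = ω i := by
    intro i hi
    obtain ⟨t', ht'⟩ := h i
    have hi' : i < (A.run τ t').2.length := by
      by_contra hcon
      rw [List.getElem?_eq_none (by omega)] at ht'
      simp at ht'
    have e : (A.run τ t').2[i] = ω i := by simpa [List.getElem?_eq_getElem hi'] using ht'
    rcases le_total t t' with hle | hle
    · rw [← e, (A.run_prefix τ hle).getElem hi]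
    · rw [← e, (A.run_prefix τ hle).getElem hi']
  obtain ⟨s, r, hs⟩ := hy
  refine ⟨s.length, List.ext_getElem (by simp [substring]) fun i hi _ => ?_⟩
  have hl : s.length + i < (A.run τ t).2.length := by
    rw [← hs]
    simp only [List.length_append]
    omega
  have e := hget _ hl
  simp only [substring, List.getElem_map, List.getElem_range]
  rw [← e]
  simp [← hs, hi]

/-- Almost surely the output is not an infinite sequence all of whose substrings of length `n` have
complexity at least `n / b - c`. -/
theorem fairCoins_produces_eq_zero {U : List Bool →. List Bool} (hU : IsOptimal U)
    (A : ProbAlgorithm) (b c : ℕ) (hb : 0 < b) :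
    fairCoins {τ | ∃ ω, A.Produces τ ω ∧ ∀ k n m : ℕ,
      complexity U (substring ω k n) ≤ m → n ≤ b * (m + c)} = 0 := by
  set E := {τ | ∃ ω, A.Produces τ ω ∧ ∀ k n m : ℕ,
      complexity U (substring ω k n) ≤ m → n ≤ b * (m + c)}
  set p := fairCoins.real A.outputsInfinite
  have hE : ∀ k : ℕ, fairCoins.real E ≤ 4 * (1 / 2) ^ k := by
    intro k
    obtain ⟨N, hN⟩ := A.exists_outputsAtLeast_lt (r := p + 1 / 2 ^ k)
      (lt_add_of_pos_right _ (by positivity))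
    -- `p` need not be computable: only the fixed natural number `⌈p * 2 ^ k⌉₊` enters the test. The
    -- parameter `s` stays free because `d` below depends on `f`.
    let good : ℕ → List (List Bool) × ℕ → Prop := fun s a =>
      IsSparse (2 * b) (N + 4 * b * s) a.1 ∧
        ⌈p * 2 ^ k⌉₊ * 2 ^ a.2 ≤ 2 ^ k * hitCount A a.1 a.2 + 3 * 2 ^ a.2
    have hgood : Computable₂ fun s a => decide (good s a) := by
      have hpow : Computable fun q : ℕ × (List (List Bool) × ℕ) => 2 ^ q.2.2 :=
        (primrec_two_pow.comp (Primrec.snd.comp Primrec.snd)).to_comp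
      have h1 : Computable fun q : ℕ × (List (List Bool) × ℕ) =>
          decide (IsSparse (2 * b) (N + 4 * b * q.1) q.2.1) :=
        ((primrecPred_isSparse (2 * b)).comp (Primrec.pair
          (Primrec.nat_add.comp (Primrec.const N)
            (Primrec.nat_mul.comp (Primrec.const (4 * b)) Primrec.fst))
          (Primrec.fst.comp Primrec.snd))).decide.to_comp
      have h2 : Computable fun q : ℕ × (List (List Bool) × ℕ) =>
          decide (⌈p * 2 ^ k⌉₊ * 2 ^ q.2.2 ≤ 2 ^ k * hitCount A q.2.1 q.2.2 + 3 * 2 ^ q.2.2) :=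
        Primrec.nat_le.decide.to_comp.comp
          (Primrec.nat_mul.to_comp.comp (Computable.const _) hpow)
          (Primrec.nat_add.to_comp.comp
            (Primrec.nat_mul.to_comp.comp (Computable.const _)
              ((computable_hitCount A).comp Computable.snd))
            (Primrec.nat_mul.to_comp.comp (Computable.const _) hpow))
      exact (Primrec.and.to_comp.comp h1 h2).of_eq fun q => by simp [good]
    obtain ⟨f, hf, hfg⟩ := exists_computable_choice hgood fun s => by
      obtain ⟨F, t, h⟩ := exists_isSparse_hitCount A (2 * b) (N + 4 * b * s) k (by omega)
      exact ⟨(F, t), decide_eq_true h⟩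
    obtain ⟨d, hd⟩ := exists_complexity_le_of_isSparse hU (Computable.fst.comp hf)
    -- With `s = c + d + 1`, a hit `y` in an output from `E` would give `|y| ≤ 2 * b * (s + d + c) <
    -- 4 * b * s`, contradicting the length bound.
    obtain ⟨hsparse, hcount⟩ := of_decide_eq_true (hfg (c + d + 1))
    have hd := hd _ _ _ hsparse
    generalize f (c + d + 1) = a at hsparse hcount hd
    obtain ⟨F, t⟩ := a
    dsimp only at hsparse hcount hd
    have hlen : ∀ y ∈ F, N + 4 * b * (c + d + 1) ≤ y.length := by
      intro y hy
      obtain ⟨i, hi, rfl⟩ := List.getElem_of_mem hy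
      have h := (hsparse i (List.mem_range.2 hi)).2
      rwa [List.getD_eq_getElem _ _ hi] at h
    set H := {τ | Hits F (A.run τ t).2}
    have hHm : MeasurableSet H := by
      simpa [H] using A.measurableSet_run (fun s => decide (Hits F s.2)) t
    have hHp : fairCoins.real H * 2 ^ t = hitCount A F t := by
      rw [hitCount, ← A.fairCoins_real_run]
      simp only [decide_eq_true_eq, H]
    have hHN : H ⊆ A.outputsAtLeast N := by
      rintro τ ⟨y, hy, hi⟩
      exact ⟨t, le_trans (by have := hlen y hy; omega) hi.length_le⟩
    have hsub : E ⊆ A.outputsAtLeast N \ H := by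
      rintro τ ⟨ω, hω, hcomp⟩
      refine ⟨?_, ?_⟩
      · obtain ⟨t', ht'⟩ := hω N
        refine ⟨t', ?_⟩
        by_contra hcon
        rw [List.getElem?_eq_none (by omega)] at ht'
        simp at ht'
      · rintro ⟨y, hy, hi⟩
        obtain ⟨j, hj⟩ := hω.eq_substring hi
        have h1 := hcomp j y.length _ (by
          rw [← hj]
          exact hd y hy)
        have h2 := hlen y hy
        have h3 := Nat.div_mul_le_self y.length (2 * b)
        nlinarith
    have hHlow : p - 3 / 2 ^ k ≤ fairCoins.real H := by
      have h1 : (⌈p * 2 ^ k⌉₊ : ℝ) * 2 ^ t ≤ 2 ^ k * hitCount A F t + 3 * 2 ^ t := by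
        exact_mod_cast hcount
      rw [← hHp] at h1
      have h2 : (⌈p * 2 ^ k⌉₊ : ℝ) ≤ 2 ^ k * fairCoins.real H + 3 := by
        refine le_of_mul_le_mul_right (h1.trans_eq (by ring)) (by positivity : (0 : ℝ) < 2 ^ t)
      have h3 := (Nat.le_ceil (p * 2 ^ k)).trans h2
      rw [sub_le_iff_le_add, ← mul_le_mul_iff_left₀ (by positivity : (0 : ℝ) < 2 ^ k), add_mul,
        div_mul_cancel₀ _ (by positivity)]
      linarith
    calc fairCoins.real E ≤ fairCoins.real (A.outputsAtLeast N \ H) := measureReal_mono hsub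
      _ = fairCoins.real (A.outputsAtLeast N) - fairCoins.real H := measureReal_sdiff hHN hHm
      _ ≤ (p + 1 / 2 ^ k) - (p - 3 / 2 ^ k) := sub_le_sub hN.le hHlow
      _ = 4 * (1 / 2) ^ k := by rw [one_div_pow]; ring
  have hlim : Filter.Tendsto (fun k : ℕ => 4 * (1 / 2 : ℝ) ^ k) Filter.atTop (nhds 0) := by
    simpa using (tendsto_pow_atTop_nhds_zero_of_lt_one (r := (1 / 2 : ℝ)) (by norm_num)
      (by norm_num)).const_mul 4
  exact (measureReal_eq_zero_iff).1
    (le_antisymm (ge_of_tendsto' hlim hE) measureReal_nonneg)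

/-- Replacing `α` by some `1 / (b + 1) < α` and the constant by a natural number leaves countably
many cases. -/
theorem IsEverywhereComplex.exists_nat_bound {U : List Bool →. List Bool} {α : ℝ}
    {ω : ℕ → Bool} (hα : 0 < α) (h : IsEverywhereComplex U α ω) :
    ∃ b c : ℕ, ∀ k n m : ℕ, complexity U (substring ω k n) ≤ m → n ≤ (b + 1) * (m + c) := by
  obtain ⟨r, hr⟩ := h
  obtain ⟨b, hb⟩ := exists_nat_one_div_lt hα
  obtain ⟨c, hc⟩ := exists_nat_ge r
  refine ⟨b, c, fun k n m hm => ?_⟩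
  have h1 : ((complexity U (substring ω k n) : ℝ≥0∞) : EReal) ≤ ((m : ℝ) : EReal) := by
    have h2 : (complexity U (substring ω k n) : ℝ≥0∞) ≤ ((m : ℕ∞) : ℝ≥0∞) := by
      exact_mod_cast hm
    have h3 := EReal.coe_ennreal_le_coe_ennreal_iff.2 h2
    exact h3.trans_eq (by rw [ENat.toENNReal_coe]; rfl)
  have h4 : α * n - r ≤ m := EReal.coe_le_coe_iff.1 ((hr k n).trans h1)
  have hb' : (0 : ℝ) < b + 1 := by positivity
  have h5 : (n : ℝ) ≤ (b + 1) * (α * n) := by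
    have : 1 ≤ (b + 1) * α := by
      rw [div_lt_iff₀ hb'] at hb
      linarith
    nlinarith [(Nat.cast_nonneg n : (0 : ℝ) ≤ n)]
  have h6 : (n : ℝ) ≤ (b + 1) * (m + c) :=
    h5.trans (mul_le_mul_of_nonneg_left (by linarith) hb'.le)
  exact_mod_cast h6

end EverywhereComplex

theorem theorem1 (U : List Bool →. List Bool) (hU : EverywhereComplex.IsOptimal U)
    (A : EverywhereComplex.ProbAlgorithm) :
    EverywhereComplex.fairCoins {τ : ℕ → Bool | ∃ ω : ℕ → Bool, A.Produces τ ω ∧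
      ∃ α : ℝ, 0 < α ∧ α < 1 ∧ EverywhereComplex.IsEverywhereComplex U α ω} = 0 := by
  refine measure_mono_null ?_ (measure_iUnion_null fun b : ℕ => measure_iUnion_null fun c : ℕ =>
    EverywhereComplex.fairCoins_produces_eq_zero hU A (b + 1) c b.succ_pos)
  rintro τ ⟨ω, hω, α, hα, -, h⟩
  obtain ⟨b, c, hbc⟩ := h.exists_nat_bound hα
  exact Set.mem_iUnion₂.2 ⟨b, c, ω, hω, hbc⟩
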